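/- A two-to-one (2:1) structure $\mathcal{A}=(A,f)$ is a non-empty set $A$ with a function $f:A\to A$ such that every $a\in A$ has exactly two preimages; it is computable if $A\subseteq\omega$ is a computable set and $f$ is a computable function on $A$. The orbit of $a\in A$ is $\{x\in A: f^n(x)=f^m(a)\text{ for some } n,m\in\omega\}$. An orbit, viewed as a directed graph with edges $(x,f(x))$, is a $Z$-chain if it consists of a one-to-one directed sequence of nodes ordered as the integers together with, for every node of the sequence, a full binary tree with edges pointing toward its root, attached by an edge from the root to that node; it is a $k$-cycle ($k\ge 1$) if it is obtained in the same way from a one-to-one directed cycle of size $k$. An infinite set $C\subseteq\omega$ is cohesive if for every c.e. set $W$ either $W\cap C$ or $\overline{W}\cap C$ is finite. The cohesive power $\Pi_C\mathcal{A}$ has as elements the classes $[\psi]$ of partial computable functions $\psi$ from $\omega$ to $A$ that are defined at all but finitely many elements of $C$, where $[\psi_1]=[\psi_2]$ iff $\psi_1(i)$ and $\psi_2(i)$ are defined and equal for all but finitely many $i\in C$; its function is $[\psi]\mapsto[f\circ\psi]$. Theorem. Let $\mathcal{A}$ be a computable 2:1 structure, let $C$ be a cohesive set, and let $\mathcal{B}=\Pi_C\mathcal{A}$.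 Then $\mathcal{B}$ is a 2:1 structure, and: (i) for every $k\ge 1$, $\mathcal{B}$ has the same number of $k$-cycles as $\mathcal{A}$; (ii) $\mathcal{B}$ has infinitely many $Z$-chains. Hence, if $\mathcal{A}$ has at most finitely many $Z$-chains, then $\mathcal{A}\not\cong\Pi_C\mathcal{A}$. Moreover, $\mathcal{A}\cong\Pi_C\mathcal{A}$ if and only if $\mathcal{A}$ has infinitely many $Z$-chains. -/

import Mathlib

/-! ### Structures with one unary function -/

/-- `(α, f)` is a two-to-one structure: the domain is non-empty and every element has exactly
two preimages. -/
def IsTwoToOne {α : Type*} (f : α → α) : Prop :=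
  Nonempty α ∧ ∀ a : α, (f ⁻¹' {a}).ncard = 2

/-- Isomorphism of structures with one unary function. -/
def UnaryIso {α β : Type*} (f : α → α) (g : β → β) : Prop :=
  ∃ e : α ≃ β, ∀ a : α, e (f a) = g (e a)

/-- The orbit of `a`: its connected component in the graph with edges `(x, f x)`. -/
def unaryOrbit {α : Type*} (f : α → α) (a : α) : Set α :=
  {x | ∃ n m : ℕ, f^[n] x = f^[m] a}

/-- The function of the structure obtained from a basic sequence of nodes, indexed by `I` and
with edges `i → i + 1`, by attaching a full binary tree to each node. The pair `(i, none)` is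
the node `i` of the basic sequence. The pairs `(i, some w)` are the nodes of the full binary tree
attached to it: nodes are binary words, the root is the empty word, the parent of `b :: w` is `w`,
all edges point to the parent, and the connecting edge goes from the root to `(i, none)`. -/
def chainWithTrees (I : Type) [Add I] [One I] :
    I × Option (List Bool) → I × Option (List Bool)
  | (i, none) => (i + 1, none)
  | (i, some []) => (i, none)
  | (i, some (_ :: w)) => (i, some w)

/-- The set of elements `O`, with the restriction of `f`, is a copy of the structure `(β, g)`. -/
def IsCopyOf {α β : Type*} (f : α → α) (O : Set α) (g : β → β) : Prop :=
  ∃ e : β → α, Function.Injective e ∧ Set.range e = O ∧ ∀ b : β, f (e b) = e (g b)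

/-- The set of those orbits of `f` that are `k`-cycles (used only for `k ≥ 1`): a one-to-one
directed cycle of size `k` with a full binary tree attached to each of its nodes. -/
def cycleOrbits {α : Type*} (f : α → α) (k : ℕ) : Set (Set α) :=
  {O | (∃ a : α, O = unaryOrbit f a) ∧ IsCopyOf f O (chainWithTrees (ZMod k))}

/-- The set of those orbits of `f` that are `Z`-chains: a one-to-one directed sequence of nodes
ordered as the integers, with a full binary tree attached to each of its nodes. -/
def zChainOrbits {α : Type*} (f : α → α) : Set (Set α) :=
  {O | (∃ a : α, O = unaryOrbit f a) ∧ IsCopyOf f O (chainWithTrees ℤ)}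

/-! ### Computable structures and cohesive powers -/

/-- A computable structure with one unary function: the domain is a computable set of natural
numbers and the function is (the restriction to the domain of) a computable function. -/
structure ComputableUnaryStructure where
  dom : Set ℕ
  fn : dom → dom
  computable_dom : ComputablePred (fun n : ℕ => n ∈ dom)
  computable_fn : ∃ F : ℕ → ℕ, Computable F ∧ ∀ a : dom, F a = fn a

/-- Inclusion of sets of natural numbers up to finitely many elements. -/
def AlmostSubset (X Y : Set ℕ) : Prop := (X \ Y).Finite

/-- An infinite set of natural numbers that no c.e. set splits into two infinite parts. -/
def IsCohesive (C : Set ℕ) : Prop :=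
  C.Infinite ∧ ∀ W : Set ℕ, REPred (fun n : ℕ => n ∈ W) → (W ∩ C).Finite ∨ (Wᶜ ∩ C).Finite

namespace ComputableUnaryStructure

/-- The partial computable functions from `ℕ` to the domain of the structure whose domain of
definition contains `C` up to finitely many elements. -/
def PreElem (A : ComputableUnaryStructure) (C : Set ℕ) : Type :=
  {ψ : ℕ →. A.dom //
    Partrec (fun i : ℕ => (ψ i).map (fun a : A.dom => (a : ℕ))) ∧ AlmostSubset C ψ.Dom}

/-- The relation `ψ₁ =_C ψ₂`: for all but finitely many `i` in `C` both values are defined and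
equal. -/
def EqOn (A : ComputableUnaryStructure) (C : Set ℕ) (ψ₁ ψ₂ : A.PreElem C) : Prop :=
  AlmostSubset C {i | ∃ a : A.dom, a ∈ ψ₁.1 i ∧ a ∈ ψ₂.1 i}

theorem eqOn_equivalence (A : ComputableUnaryStructure) (C : Set ℕ) :
    Equivalence (A.EqOn C) where
  refl ψ := by
    refine ψ.2.2.subset ?_
    rintro i ⟨hi, h⟩
    refine ⟨hi, fun hd => h ?_⟩
    obtain ⟨a, ha⟩ := Part.dom_iff_mem.1 ((PFun.mem_dom _ _).2 ((PFun.mem_dom _ _).1 hd))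
    exact ⟨a, ha, ha⟩
  symm := by
    intro ψ₁ ψ₂ h
    refine Set.Finite.subset h ?_
    rintro i ⟨hi, h'⟩
    exact ⟨hi, fun ⟨a, h₁, h₂⟩ => h' ⟨a, h₂, h₁⟩⟩
  trans := by
    intro ψ₁ ψ₂ ψ₃ h h'
    refine Set.Finite.subset (Set.Finite.union h h') ?_
    rintro i ⟨hi, hn⟩
    by_contra hc
    simp only [Set.mem_union, Set.mem_sdiff, hi, true_and, not_or, not_not] at hc
    obtain ⟨⟨a, h₁, h₂⟩, ⟨b, h₃, h₄⟩⟩ := hc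
    obtain rfl := Part.mem_unique h₂ h₃
    exact hn ⟨a, h₁, h₄⟩

def powerSetoid (A : ComputableUnaryStructure) (C : Set ℕ) : Setoid (A.PreElem C) :=
  ⟨A.EqOn C, A.eqOn_equivalence C⟩

/-- The domain of the cohesive power of the structure over `C`. -/
def Power (A : ComputableUnaryStructure) (C : Set ℕ) : Type :=
  Quotient (A.powerSetoid C)

/-- The function `i ↦ f (ψ i)`, defined exactly where `ψ` is. -/
def preMap (A : ComputableUnaryStructure) (C : Set ℕ) (ψ : A.PreElem C) : A.PreElem C :=
  ⟨fun i => (ψ.1 i).map A.fn, by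
    obtain ⟨F, hF, hFA⟩ := A.computable_fn
    refine (Partrec.map ψ.2.1 (hF.comp Computable.snd).to₂).of_eq fun i => ?_
    rw [Part.map_map, Part.map_map]
    congr 1
    funext a
    exact hFA a, ψ.2.2⟩

/-- The function of the cohesive power over `C`: `[ψ] ↦ [f ∘ ψ]`. -/
def powerFn (A : ComputableUnaryStructure) (C : Set ℕ) : A.Power C → A.Power C :=
  Quotient.map (sa := A.powerSetoid C) (sb := A.powerSetoid C) (A.preMap C) (by
    intro ψ₁ ψ₂ h
    refine Set.Finite.subset h ?_
    rintro i ⟨hi, hn⟩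
    exact ⟨hi, fun ⟨a, h₁, h₂⟩ => hn ⟨A.fn a, Part.mem_map _ h₁, Part.mem_map _ h₂⟩⟩)

end ComputableUnaryStructure

/-! In a 2:1 structure an orbit contains at most one cycle, and its length determines the orbit up
to isomorphism: each node of the cycle, or of a bi-infinite path when there is no cycle, has exactly
one preimage off it, above which sits a full binary tree. As `ZMod 0` is `ℤ`, the case `k = 0` of a
`k`-cycle is a Z-chain, and both kinds are treated together. A 2:1 structure is thus determined by
the number of its orbits for each `k` (`IsTwoToOne.unaryIso_of_cycleOrbits`).

The cohesive power behaves like an ultrapower for equations between iterates. The set of indices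
where two partial computable functions agree is c.e., so along the cofinite filter on `C` they are
eventually equal or eventually different (`eqOn_or_eventually_ne`). Computable selectors for the two
preimages then make the power 2:1. If `A` has finitely many points of minimal period `k`, each such
point of the power is a constant; otherwise both structures have `ℵ₀` many `k`-cycles, since the
power is countable.

For Z-chains, take a non-periodic `a` and a computable right inverse `s` of `f`. The elements `i ↦
s^(i(j+1)) a`, for `j : ℕ`, recede from `a` at different speeds, so no two lie in one orbit and none
is in the orbit of a cycle (`infinite_zChainOrbits_powerFn`). Together with the orbit count this
settles the isomorphism question. -/

/-! ### Orbits -/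

theorem mem_unaryOrbit_self {α : Type*} (f : α → α) (a : α) : a ∈ unaryOrbit f a :=
  ⟨0, 0, rfl⟩

theorem unaryOrbit_eq_of_iterate_eq {α : Type*} {f : α → α} {x a : α} {n m : ℕ}
    (h : f^[n] x = f^[m] a) : unaryOrbit f x = unaryOrbit f a := by
  have key : ∀ {x a : α} {n m : ℕ}, f^[n] x = f^[m] a → unaryOrbit f x ⊆ unaryOrbit f a := by
    rintro x a n m h y ⟨p, q, hy⟩
    refine ⟨n + p, q + m, ?_⟩
    rw [Function.iterate_add_apply, hy, ← Function.iterate_add_apply, Nat.add_comm,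
      Function.iterate_add_apply, h, ← Function.iterate_add_apply]
  exact Set.Subset.antisymm (key h) (key h.symm)

theorem unaryOrbit_eq_of_mem {α : Type*} {f : α → α} {x a : α} (h : x ∈ unaryOrbit f a) :
    unaryOrbit f x = unaryOrbit f a := by
  obtain ⟨n, m, h⟩ := h
  exact unaryOrbit_eq_of_iterate_eq h

theorem mem_unaryOrbit_of_eq {α : Type*} {f : α → α} {x a : α}
    (h : unaryOrbit f x = unaryOrbit f a) : x ∈ unaryOrbit f a :=
  h ▸ mem_unaryOrbit_self f x

theorem eq_or_eq_of_ncard_eq_two {α : Type*} {s : Set α} (hs : s.ncard = 2) {x y z : α}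
    (hx : x ∈ s) (hy : y ∈ s) (hz : z ∈ s) (hxy : x ≠ y) : z = x ∨ z = y := by
  obtain ⟨a, b, hab, rfl⟩ := Set.ncard_eq_two.1 hs
  simp only [Set.mem_insert_iff, Set.mem_singleton_iff] at hx hy hz
  rcases hx with rfl | rfl <;> rcases hy with rfl | rfl <;> simp_all
  exact hz.symm

/-! ### The structure `chainWithTrees (ZMod k)` -/

theorem chainWithTrees_iterate_none (k n : ℕ) (i : ZMod k) :
    (chainWithTrees (ZMod k))^[n] (i, none) = (i + n, none) := by
  induction n with
  | zero => simp
  | succ n ih =>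
    rw [Function.iterate_succ_apply', ih]
    simp [chainWithTrees, add_assoc]

theorem chainWithTrees_iterate_some (k : ℕ) (i : ZMod k) (w : List Bool) :
    (chainWithTrees (ZMod k))^[w.length + 1] (i, some w) = (i, none) := by
  induction w with
  | nil => rfl
  | cons b w ih =>
    rw [List.length_cons, Function.iterate_succ_apply]
    exact ih

theorem chainWithTrees_exists_iterate (k : ℕ) (t : ZMod k × Option (List Bool)) :
    ∃ n, (chainWithTrees (ZMod k))^[n] t = (t.1, none) := by
  obtain ⟨i, _ | w⟩ := t
  · exact ⟨0, rfl⟩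
  · exact ⟨_, chainWithTrees_iterate_some k i w⟩

theorem exists_natCast_eq_add_natCast (k : ℕ) (i : ZMod k) :
    ∃ n m : ℕ, i + n = m := by
  obtain _ | k := k
  -- In `ℤ` a negative node first has to move forward to reach `0`.
  · obtain ⟨n, rfl | rfl⟩ := Int.eq_nat_or_neg (i : ℤ)
    · exact ⟨0, n, add_zero (n : ℤ)⟩
    · exact ⟨n, 0, neg_add_cancel (n : ℤ)⟩
  · exact ⟨0, ZMod.val i, by simp⟩

theorem chainWithTrees_exists_iterate_eq (k : ℕ) (t : ZMod k × Option (List Bool)) :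
    ∃ n m, (chainWithTrees (ZMod k))^[n] t = (chainWithTrees (ZMod k))^[m] (0, none) := by
  obtain ⟨n, hn⟩ := chainWithTrees_exists_iterate k t
  obtain ⟨p, q, hpq⟩ := exists_natCast_eq_add_natCast k t.1
  refine ⟨p + n, q, ?_⟩
  rw [Function.iterate_add_apply, hn, chainWithTrees_iterate_none, chainWithTrees_iterate_none,
    hpq, zero_add]

theorem chainWithTrees_isPeriodicPt_none (k n : ℕ) (i : ZMod k) :
    Function.IsPeriodicPt (chainWithTrees (ZMod k)) n (i, none) ↔ k ∣ n := by
  rw [Function.IsPeriodicPt, Function.IsFixedPt, chainWithTrees_iterate_none]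
  simp [ZMod.natCast_eq_zero_iff]

theorem chainWithTrees_dvd_of_isPeriodicPt {k n : ℕ} {t : ZMod k × Option (List Bool)}
    (h : Function.IsPeriodicPt (chainWithTrees (ZMod k)) n t) : k ∣ n := by
  obtain ⟨m, hm⟩ := chainWithTrees_exists_iterate k t
  have := h.apply_iterate m
  rwa [hm, chainWithTrees_isPeriodicPt_none] at this

theorem chainWithTrees_exists_two_preimages (k : ℕ) (t : ZMod k × Option (List Bool)) :
    ∃ t₁ t₂, t₁ ≠ t₂ ∧ chainWithTrees (ZMod k) t₁ = t ∧ chainWithTrees (ZMod k) t₂ = t := by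
  obtain ⟨i, _ | w⟩ := t
  · exact ⟨(i - 1, none), (i, some []), by simp, by simp [chainWithTrees], rfl⟩
  · exact ⟨(i, some (false :: w)), (i, some (true :: w)), by simp, rfl, rfl⟩

theorem iterate_hom {α β : Type*} {f : α → α} {g : β → β} {e : β → α}
    (he : ∀ b, f (e b) = e (g b)) (n : ℕ) (b : β) : f^[n] (e b) = e (g^[n] b) :=
  ((Function.Semiconj.iterate_right (f := e) (ga := g) (gb := f) fun b => (he b).symm) n b).symm

theorem isPeriodicPt_hom {α β : Type*} {f : α → α} {g : β → β} {e : β → α}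
    (hi : Function.Injective e) (he : ∀ b, f (e b) = e (g b)) (n : ℕ) (b : β) :
    Function.IsPeriodicPt f n (e b) ↔ Function.IsPeriodicPt g n b := by
  simp only [Function.IsPeriodicPt, Function.IsFixedPt, iterate_hom he, hi.eq_iff]

/-! ### Recognizing orbits -/

/-- The periods occurring in an orbit recover `k`; for `k = 0` only the trivial period `0` occurs.
-/
theorem isCopyOf_chainWithTrees_dvd_iff {α : Type*} {f : α → α} {O : Set α} {k : ℕ}
    (h : IsCopyOf f O (chainWithTrees (ZMod k))) (n : ℕ) :
    (∃ x ∈ O, Function.IsPeriodicPt f n x) ↔ k ∣ n := by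
  obtain ⟨e, hi, rfl, he⟩ := h
  constructor
  · rintro ⟨_, ⟨t, rfl⟩, ht⟩
    exact chainWithTrees_dvd_of_isPeriodicPt ((isPeriodicPt_hom hi he n t).1 ht)
  · intro hk
    exact ⟨e (0, none), ⟨_, rfl⟩,
      (isPeriodicPt_hom hi he n _).2 ((chainWithTrees_isPeriodicPt_none k n 0).2 hk)⟩

theorem isCopyOf_chainWithTrees_unique {α : Type*} {f : α → α} {O : Set α} {k l : ℕ}
    (h : IsCopyOf f O (chainWithTrees (ZMod k))) (h' : IsCopyOf f O (chainWithTrees (ZMod l))) :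
    k = l := by
  apply Nat.dvd_antisymm
  · rw [← isCopyOf_chainWithTrees_dvd_iff h, isCopyOf_chainWithTrees_dvd_iff h']
  · rw [← isCopyOf_chainWithTrees_dvd_iff h', isCopyOf_chainWithTrees_dvd_iff h]

/-- The image of the node `w` of a binary tree, when `r` is the image of the root and `p b y` is
the preimage of `y` chosen for the child `b`. -/
def treeNode {α : Type*} (r : α) (p : Bool → α → α) : List Bool → α
  | [] => r
  | b :: w => p b (treeNode r p w)

/-- The extension of a base sequence to the attached trees, with the `i`-th root at `r i`. -/
def treeExtension {α I : Type*} (base r : I → α) (p : Bool → α → α) :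
    I × Option (List Bool) → α
  | (i, none) => base i
  | (i, some w) => treeNode (r i) p w

/-- The trees are grown by choosing preimages. Injectivity follows by applying `f` until a root is
reached. The image is closed under preimages because the two preimages of a node already account for
both preimages of its image, and it meets the whole orbit. -/
theorem IsTwoToOne.isCopyOf_of_base {α : Type*} {f : α → α} (hf : IsTwoToOne f) {k : ℕ}
    (base : ZMod k → α) (hinj : Function.Injective base)
    (hbase : ∀ i, f (base i) = base (i + 1)) :
    IsCopyOf f (unaryOrbit f (base 0)) (chainWithTrees (ZMod k)) := by
  have hp : ∀ y, ∃ q : Bool → α, q false ≠ q true ∧ ∀ b, f (q b) = y := by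
    intro y
    obtain ⟨u, v, huv, h⟩ := Set.ncard_eq_two.1 (hf.2 y)
    have hu : u ∈ f ⁻¹' {y} := by simp [h]
    have hv : v ∈ f ⁻¹' {y} := by simp [h]
    refine ⟨fun b => bif b then v else u, huv, ?_⟩
    rintro (_ | _)
    exacts [hu, hv]
  choose q hqne hq using hp
  -- The two selected preimages differ, so one of them is off the base.
  have hr : ∀ i, ∃ y, f y = base i ∧ y ≠ base (i - 1) := by
    intro i
    by_cases h : q (base i) false = base (i - 1)
    · exact ⟨q (base i) true, hq _ _, fun h' => hqne _ (h.trans h'.symm)⟩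
    · exact ⟨q (base i) false, hq _ _, h⟩
  choose r hrf hrne using hr
  set e := treeExtension base r (fun b y => q y b) with he
  have hom : ∀ t, f (e t) = e (chainWithTrees (ZMod k) t) := by
    rintro ⟨i, _ | _ | ⟨b, w⟩⟩
    exacts [hbase i, hrf i, hq _ _]
  have hsome : ∀ w i j, e (i, some w) ≠ base j := by
    intro w
    induction w with
    | nil =>
      intro i j h
      have h₁ : base i = base (j + 1) := by rw [← hrf, ← hbase, ← h]; rfl
      have h₂ : j = i - 1 := by rw [hinj h₁]; ring
      exact hrne i (h.trans (by rw [h₂]))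
    | cons b w ih =>
      intro i j h
      exact ih i (j + 1) (by rw [← hbase, ← h]; exact (hom (i, some (b :: w))).symm)
  have hsomeinj : ∀ w v i j, e (i, some w) = e (j, some v) → i = j ∧ w = v := by
    intro w
    induction w with
    | nil =>
      intro v i j h
      have h' := congrArg f h
      rw [hom, hom] at h'
      obtain _ | ⟨b, v⟩ := v
      · exact ⟨hinj h', rfl⟩
      · exact absurd h'.symm (hsome v j i)
    | cons b w ih =>
      intro v i j h
      have h' := congrArg f h
      rw [hom, hom] at h'
      obtain _ | ⟨c, v⟩ := v
      · exact absurd h' (hsome w i j)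
      · obtain ⟨rfl, rfl⟩ := ih v i j h'
        refine ⟨rfl, ?_⟩
        have h'' : q (e (i, some w)) b = q (e (i, some w)) c := h
        have hne := hqne (e (i, some w))
        cases b <;> cases c
        exacts [rfl, absurd h'' hne, absurd h''.symm hne, rfl]
  have hei : Function.Injective e := by
    rintro ⟨i, _ | w⟩ ⟨j, _ | v⟩ h
    · exact congrArg (·, none) (hinj h)
    · exact absurd h.symm (hsome v j i)
    · exact absurd h (hsome w i j)
    · obtain ⟨rfl, rfl⟩ := hsomeinj w v i j h
      rfl
  refine ⟨e, hei, ?_, hom⟩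
  have hpre : ∀ x, f x ∈ Set.range e → x ∈ Set.range e := by
    rintro x ⟨t, ht⟩
    obtain ⟨t₁, t₂, hne, h₁, h₂⟩ := chainWithTrees_exists_two_preimages k t
    rcases eq_or_eq_of_ncard_eq_two (hf.2 (f x)) (x := e t₁) (y := e t₂) (z := x)
      (by simp [hom, h₁, ht]) (by simp [hom, h₂, ht]) rfl (hei.ne hne) with rfl | rfl
    exacts [⟨_, rfl⟩, ⟨_, rfl⟩]
  have hpre' : ∀ n x, f^[n] x ∈ Set.range e → x ∈ Set.range e := by
    intro n
    induction n with
    | zero => exact fun x h => h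
    | succ n ih => exact fun x h => hpre x (ih _ h)
  ext x
  constructor
  · rintro ⟨t, rfl⟩
    obtain ⟨n, m, h⟩ := chainWithTrees_exists_iterate_eq k t
    refine ⟨n, m, ?_⟩
    change _ = f^[m] (e (0, none))
    rw [iterate_hom hom, iterate_hom hom, h]
  · rintro ⟨n, m, h⟩
    refine hpre' n x ?_
    rw [h]
    change f^[m] (e (0, none)) ∈ _
    rw [iterate_hom hom]
    exact ⟨_, rfl⟩

theorem IsTwoToOne.surjective {α : Type*} {f : α → α} (hf : IsTwoToOne f) :
    Function.Surjective f := by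
  intro y
  have h : (f ⁻¹' {y}).Nonempty := Set.nonempty_of_ncard_ne_zero (by rw [hf.2 y]; decide)
  exact h

theorem IsTwoToOne.isCopyOf_minimalPeriod {α : Type*} {f : α → α} (hf : IsTwoToOne f) {x : α}
    (hx : 0 < Function.minimalPeriod f x) :
    IsCopyOf f (unaryOrbit f x) (chainWithTrees (ZMod (Function.minimalPeriod f x))) := by
  set k := Function.minimalPeriod f x with hk
  have : NeZero k := ⟨hx.ne'⟩
  have h := hf.isCopyOf_of_base (k := k) (fun i => f^[i.val] x) ?_ ?_
  · simpa using h
  · intro i j hij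
    exact ZMod.val_injective k (Function.iterate_injOn_Iio_minimalPeriod
      (ZMod.val_lt i) (ZMod.val_lt j) hij)
  · intro i
    rw [ZMod.val_add, ZMod.val_one_eq_one_mod, Nat.add_mod_mod,
      Function.iterate_mod_minimalPeriod_eq, Function.iterate_succ_apply']

-- A right inverse of `f` continues the forward path of `a` backwards; a repetition on this path
-- would be a periodic point of the orbit.
theorem IsTwoToOne.isCopyOf_int {α : Type*} {f : α → α} (hf : IsTwoToOne f) {a : α}
    (ha : ∀ x ∈ unaryOrbit f a, x ∉ Function.periodicPts f) :
    IsCopyOf f (unaryOrbit f a) (chainWithTrees (ZMod 0)) := by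
  obtain ⟨s, hs⟩ := hf.surjective.hasRightInverse
  have hsn : ∀ n, f^[n] (s^[n] a) = a := fun n => hs.iterate n a
  let base : ℤ → α
    | Int.ofNat n => f^[n] a
    | Int.negSucc n => s^[n + 1] a
  have hbase : ∀ i, f (base i) = base (i + 1) := by
    rintro (n | n)
    · exact (Function.iterate_succ_apply' f n a).symm
    · obtain _ | n := n
      · exact hs a
      · have : (Int.negSucc (n + 1) + 1 : ℤ) = Int.negSucc n := by omega
        rw [this]
        change f (s^[n + 1 + 1] a) = s^[n + 1] a
        rw [Function.iterate_succ_apply', hs]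
  have hiter : ∀ (n : ℕ) i, f^[n] (base i) = base (i + n) := by
    intro n
    induction n with
    | zero => simp
    | succ n ih =>
      intro i
      rw [Function.iterate_succ_apply', ih, hbase, Nat.cast_succ, add_assoc]
  have horb : ∀ i, base i ∈ unaryOrbit f a := by
    rintro (n | n)
    · exact ⟨0, n, rfl⟩
    · exact ⟨n + 1, 0, hsn (n + 1)⟩
  have hlt : ∀ i j, i < j → base i ≠ base j := by
    intro i j hij h
    refine ha _ (horb i) ⟨(j - i).toNat, by omega, ?_⟩
    rw [Function.IsPeriodicPt, Function.IsFixedPt, hiter, h]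
    congr 1
    omega
  refine hf.isCopyOf_of_base (k := 0) base (fun (i j : ℤ) hij => ?_) hbase
  rcases lt_trichotomy i j with h | h | h
  exacts [absurd hij (hlt _ _ h), h, absurd hij.symm (hlt _ _ h)]

theorem IsTwoToOne.exists_isCopyOf {α : Type*} {f : α → α} (hf : IsTwoToOne f) (a : α) :
    ∃ k, IsCopyOf f (unaryOrbit f a) (chainWithTrees (ZMod k)) := by
  by_cases h : ∃ x ∈ unaryOrbit f a, x ∈ Function.periodicPts f
  · obtain ⟨x, hx, hp⟩ := h
    rw [← unaryOrbit_eq_of_mem hx]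
    exact ⟨_, hf.isCopyOf_minimalPeriod (Function.minimalPeriod_pos_of_mem_periodicPts hp)⟩
  · push Not at h
    exact ⟨0, hf.isCopyOf_int h⟩

theorem IsTwoToOne.exists_mem_cycleOrbits {α : Type*} {f : α → α} (hf : IsTwoToOne f) (a : α) :
    ∃ k, unaryOrbit f a ∈ cycleOrbits f k := by
  obtain ⟨k, hk⟩ := hf.exists_isCopyOf a
  exact ⟨k, ⟨a, rfl⟩, hk⟩

theorem IsTwoToOne.mem_zChainOrbits {α : Type*} {f : α → α} (hf : IsTwoToOne f) {a : α}
    (ha : ∀ n m, f^[n] a = f^[m] a → n = m) : unaryOrbit f a ∈ zChainOrbits f := by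
  refine ⟨⟨a, rfl⟩, hf.isCopyOf_int ?_⟩
  rintro x ⟨p, q, h⟩ ⟨n, hn, hx⟩
  have h₁ := hx.apply_iterate p
  rw [h, Function.IsPeriodicPt, Function.IsFixedPt, ← Function.iterate_add_apply] at h₁
  have := ha _ _ h₁
  omega

/-- Reduces counting cycles to counting points. It needs `1 ≤ k`: `minimalPeriod` is `0` at every
non-periodic point, including the tree nodes above a cycle. -/
theorem cycleOrbits_eq_image {α : Type*} {f : α → α} (hf : IsTwoToOne f) {k : ℕ} (hk : 1 ≤ k) :
    cycleOrbits f k = unaryOrbit f '' {x | Function.minimalPeriod f x = k} := by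
  ext O
  constructor
  · rintro ⟨⟨a, rfl⟩, e, hi, hr, he⟩
    refine ⟨e (0, none), ?_, unaryOrbit_eq_of_mem (hr ▸ ⟨_, rfl⟩)⟩
    apply Nat.dvd_antisymm
    · rw [← Function.isPeriodicPt_iff_minimalPeriod_dvd, isPeriodicPt_hom hi he,
        chainWithTrees_isPeriodicPt_none]
    · rw [← chainWithTrees_isPeriodicPt_none k _ 0, ← isPeriodicPt_hom hi he]
      exact Function.isPeriodicPt_minimalPeriod _ _
  · rintro ⟨x, rfl, rfl⟩
    exact ⟨⟨x, rfl⟩, hf.isCopyOf_minimalPeriod hk⟩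

/-! ### Classification -/

/-- The disjoint union, over all `k`, of as many copies of `chainWithTrees (ZMod k)` as there are
elements of `T k`. -/
def sumOfChains (T : ℕ → Type*) :
    (Σ k, T k × (ZMod k × Option (List Bool))) → Σ k, T k × (ZMod k × Option (List Bool)) :=
  fun x => ⟨x.1, x.2.1, chainWithTrees (ZMod x.1) x.2.2⟩

theorem UnaryIso.symm {α β : Type*} {f : α → α} {g : β → β} (h : UnaryIso f g) :
    UnaryIso g f := by
  obtain ⟨e, he⟩ := h
  refine ⟨e.symm, fun b => ?_⟩
  rw [Equiv.symm_apply_eq, he, Equiv.apply_symm_apply]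

theorem UnaryIso.trans {α β γ : Type*} {f : α → α} {g : β → β} {h : γ → γ}
    (h₁ : UnaryIso f g) (h₂ : UnaryIso g h) : UnaryIso f h := by
  obtain ⟨e₁, he₁⟩ := h₁
  obtain ⟨e₂, he₂⟩ := h₂
  exact ⟨e₁.trans e₂, fun a => by simp [he₁, he₂]⟩

theorem IsTwoToOne.unaryIso_sumOfChains {α : Type*} {f : α → α} (hf : IsTwoToOne f) :
    UnaryIso (sumOfChains fun k => cycleOrbits f k) f := by
  have hcopy : ∀ k (O : cycleOrbits f k), IsCopyOf f O.1 (chainWithTrees (ZMod k)) :=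
    fun k O => O.2.2
  choose e hi hr he using hcopy
  let F : (Σ k, cycleOrbits f k × (ZMod k × Option (List Bool))) → α := fun x => e x.1 x.2.1 x.2.2
  have hF : ∀ k (O : cycleOrbits f k) t, unaryOrbit f (e k O t) = O.1 := by
    rintro k ⟨_, ⟨a, rfl⟩, h⟩ t
    exact unaryOrbit_eq_of_mem ((hr k ⟨_, ⟨a, rfl⟩, h⟩).subset ⟨t, rfl⟩)
  have hbij : Function.Bijective F := by
    constructor
    · rintro ⟨k, O, t⟩ ⟨l, O', t'⟩ h
      have h' : e k O t = e l O' t' := h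
      have hO : O.1 = O'.1 := by rw [← hF k O t, ← hF l O' t', h']
      obtain rfl : k = l := isCopyOf_chainWithTrees_unique O.2.2 (hO ▸ O'.2.2)
      obtain rfl : O = O' := Subtype.ext hO
      rw [hi k O h']
    · intro a
      obtain ⟨k, hk⟩ := hf.exists_mem_cycleOrbits a
      have ha : a ∈ Set.range (e k ⟨_, hk⟩) := by
        rw [hr]
        exact mem_unaryOrbit_self f a
      obtain ⟨t, ht⟩ := ha
      exact ⟨⟨k, ⟨_, hk⟩, t⟩, ht⟩
  exact ⟨Equiv.ofBijective F hbij, fun x => (he x.1 x.2.1 x.2.2).symm⟩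

theorem IsTwoToOne.unaryIso_of_cycleOrbits {α β : Type*} {f : α → α} {g : β → β}
    (hf : IsTwoToOne f) (hg : IsTwoToOne g)
    (h : ∀ k, Nonempty (cycleOrbits f k ≃ cycleOrbits g k)) : UnaryIso f g := by
  have e := fun k => (h k).some
  refine hf.unaryIso_sumOfChains.symm.trans (UnaryIso.trans ?_ hg.unaryIso_sumOfChains)
  exact ⟨Equiv.sigmaCongrRight fun k => (e k).prodCongr (Equiv.refl _), fun _ => rfl⟩

theorem UnaryIso.infinite_zChainOrbits {α β : Type*} {f : α → α} {g : β → β}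
    (h : UnaryIso f g) (hf : (zChainOrbits f).Infinite) : (zChainOrbits g).Infinite := by
  obtain ⟨e, he⟩ := h
  refine (hf.image (e.injective.image_injective.injOn)).mono ?_
  rintro _ ⟨O, ⟨⟨a, rfl⟩, c, hi, hr, hc⟩, rfl⟩
  refine ⟨⟨e a, ?_⟩, e ∘ c, e.injective.comp hi, by rw [Set.range_comp, hr], fun b => ?_⟩
  · have hit := iterate_hom (f := g) (g := f) (e := e) fun a => (he a).symm
    ext y
    constructor
    · rintro ⟨x, ⟨n, m, hx⟩, rfl⟩
      exact ⟨n, m, by rw [hit, hit, hx]⟩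
    · rintro ⟨n, m, hy⟩
      refine ⟨e.symm y, ⟨n, m, e.injective ?_⟩, e.apply_symm_apply y⟩
      rw [← hit, ← hit, e.apply_symm_apply, hy]
  · rw [Function.comp_apply, ← he, hc, Function.comp_apply]

/-! ### The filter of a cohesive set -/

theorem almostSubset_iff_eventually {C S : Set ℕ} :
    AlmostSubset C S ↔ ∀ᶠ i in Filter.cofinite ⊓ Filter.principal C, i ∈ S := by
  rw [Filter.eventually_inf_principal, Filter.eventually_cofinite]
  simp only [Classical.not_imp]
  rfl

theorem IsCohesive.neBot {C : Set ℕ} (hC : IsCohesive C) :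
    (Filter.cofinite ⊓ Filter.principal C).NeBot :=
  Filter.cofinite_inf_principal_neBot_iff.2 hC.1

theorem IsCohesive.eventually_or {C : Set ℕ} (hC : IsCohesive C) {p : ℕ → Prop} (hp : REPred p) :
    (∀ᶠ i in Filter.cofinite ⊓ Filter.principal C, p i) ∨
      ∀ᶠ i in Filter.cofinite ⊓ Filter.principal C, ¬ p i := by
  simp only [Filter.eventually_inf_principal, Filter.eventually_cofinite]
  rcases hC.2 {i | p i} hp with h | h
  · refine Or.inr (h.subset ?_)
    intro i hi
    simp only [Set.mem_ofPred_eq, Classical.not_imp, not_not] at hi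
    exact ⟨hi.2, hi.1⟩
  · refine Or.inl (h.subset ?_)
    intro i hi
    simp only [Set.mem_ofPred_eq, Classical.not_imp] at hi
    exact ⟨hi.2, hi.1⟩

/-! ### Transfer of equations to the cohesive power -/

namespace ComputableUnaryStructure

variable {A : ComputableUnaryStructure} {C : Set ℕ}

theorem eqOn_iff_eventually {ψ φ : A.PreElem C} :
    A.EqOn C ψ φ ↔ ∀ᶠ i in Filter.cofinite ⊓ Filter.principal C,
      ∃ a : A.dom, a ∈ ψ.1 i ∧ a ∈ φ.1 i :=
  almostSubset_iff_eventually

theorem PreElem.eventually_defined (ψ : A.PreElem C) :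
    ∀ᶠ i in Filter.cofinite ⊓ Filter.principal C, ∃ a : A.dom, a ∈ ψ.1 i := by
  filter_upwards [almostSubset_iff_eventually.1 ψ.2.2] with i hi
  exact Part.dom_iff_mem.1 hi

/-- Agreement is c.e.: compute both values and halt when they coincide. Cohesiveness decides this
set. -/
theorem eqOn_or_eventually_ne (hC : IsCohesive C) (ψ φ : A.PreElem C) :
    A.EqOn C ψ φ ∨ ∀ᶠ i in Filter.cofinite ⊓ Filter.principal C,
      ∀ a ∈ ψ.1 i, ∀ b ∈ φ.1 i, a ≠ b := by
  have hre : REPred fun i => ∃ a : A.dom, a ∈ ψ.1 i ∧ a ∈ φ.1 i := by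
    have h : Partrec fun i : ℕ => ((ψ.1 i).map (fun a : A.dom => (a : ℕ))).bind fun x =>
        ((φ.1 i).map (fun a : A.dom => (a : ℕ))).bind fun y =>
          Part.ofOption (bif x == y then Option.some () else Option.none : Option Unit) := by
      have h₁ : Computable fun z : (ℕ × ℕ) × ℕ =>
          (bif z.1.2 == z.2 then Option.some () else Option.none : Option Unit) :=
        Computable.cond (Primrec.beq.to_comp.comp (Computable.snd.comp Computable.fst)
          Computable.snd) (Computable.const _) (Computable.const _)
      have h₂ : Partrec fun z : ℕ × ℕ => ((φ.1 z.1).map (fun a : A.dom => (a : ℕ))).bind fun y =>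
          Part.ofOption (bif z.2 == y then Option.some () else Option.none : Option Unit) :=
        Partrec.bind (φ.2.1.comp Computable.fst) h₁.ofOption.to₂
      exact Partrec.bind ψ.2.1 h₂.to₂
    refine h.dom_re.of_eq fun i => ?_
    rw [Part.dom_iff_mem]
    constructor
    · rintro ⟨_, h⟩
      simp only [Part.mem_bind_iff, Part.mem_map_iff] at h
      obtain ⟨_, ⟨a, ha, rfl⟩, _, ⟨b, hb, rfl⟩, h⟩ := h
      by_cases hab : (a : ℕ) = b
      · obtain rfl := Subtype.ext hab
        exact ⟨a, ha, hb⟩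
      · rw [beq_false_of_ne hab] at h
        simp at h
    · rintro ⟨a, ha, hb⟩
      refine ⟨(), ?_⟩
      simp only [Part.mem_bind_iff, Part.mem_map_iff]
      exact ⟨_, ⟨a, ha, rfl⟩, _, ⟨a, hb, rfl⟩, by simp⟩
  rcases hC.eventually_or hre with h | h
  · exact Or.inl (eqOn_iff_eventually.2 h)
  · refine Or.inr (h.mono fun i hi a ha b hb hab => hi ⟨a, ha, hab ▸ hb⟩)

/-- The class of a partial computable function in the cohesive power. -/
def toPower (ψ : A.PreElem C) : A.Power C := Quotient.mk (A.powerSetoid C) ψ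

theorem toPower_surjective : Function.Surjective (toPower : A.PreElem C → A.Power C) :=
  Quotient.mk_surjective

theorem toPower_eq_iff {ψ φ : A.PreElem C} : toPower ψ = toPower φ ↔ A.EqOn C ψ φ :=
  ⟨fun h => Quotient.exact h, fun h => Quotient.sound (s := A.powerSetoid C) h⟩

theorem powerFn_iterate_toPower (n : ℕ) (ψ : A.PreElem C) :
    (A.powerFn C)^[n] (toPower ψ) = toPower ((A.preMap C)^[n] ψ) := by
  induction n with
  | zero => rfl
  | succ n ih =>
    rw [Function.iterate_succ_apply', Function.iterate_succ_apply', ih]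
    rfl

theorem preMap_iterate_apply (n : ℕ) (ψ : A.PreElem C) (i : ℕ) :
    ((A.preMap C)^[n] ψ).1 i = (ψ.1 i).map A.fn^[n] := by
  induction n with
  | zero => exact (Part.map_id' (fun _ => rfl) _).symm
  | succ n ih =>
    rw [Function.iterate_succ_apply', Function.iterate_succ']
    change (((A.preMap C)^[n] ψ).1 i).map A.fn = _
    rw [ih, Part.map_map]

theorem powerFn_iterate_eq_iff (n m : ℕ) (ψ φ : A.PreElem C) :
    (A.powerFn C)^[n] (toPower ψ) = (A.powerFn C)^[m] (toPower φ) ↔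
      ∀ᶠ i in Filter.cofinite ⊓ Filter.principal C,
        ∃ a ∈ ψ.1 i, ∃ b ∈ φ.1 i, A.fn^[n] a = A.fn^[m] b := by
  rw [powerFn_iterate_toPower, powerFn_iterate_toPower, toPower_eq_iff, eqOn_iff_eventually]
  refine Filter.eventually_congr (Filter.Eventually.of_forall fun i => ?_)
  simp only [preMap_iterate_apply, Part.mem_map_iff]
  constructor
  · rintro ⟨_, ⟨a, ha, rfl⟩, b, hb, h⟩
    exact ⟨a, ha, b, hb, h.symm⟩
  · rintro ⟨a, ha, b, hb, h⟩
    exact ⟨_, ⟨a, ha, rfl⟩, b, hb, h.symm⟩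

theorem powerFn_iterate_ne_iff (hC : IsCohesive C) (n m : ℕ) (ψ φ : A.PreElem C) :
    (A.powerFn C)^[n] (toPower ψ) ≠ (A.powerFn C)^[m] (toPower φ) ↔
      ∀ᶠ i in Filter.cofinite ⊓ Filter.principal C,
        ∀ a ∈ ψ.1 i, ∀ b ∈ φ.1 i, A.fn^[n] a ≠ A.fn^[m] b := by
  constructor
  · intro h
    rw [powerFn_iterate_toPower, powerFn_iterate_toPower, Ne, toPower_eq_iff] at h
    refine ((eqOn_or_eventually_ne hC _ _).resolve_left h).mono fun i hi a ha b hb => ?_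
    rw [preMap_iterate_apply, preMap_iterate_apply] at hi
    exact hi _ (Part.mem_map _ ha) _ (Part.mem_map _ hb)
  · intro h h'
    rw [powerFn_iterate_eq_iff] at h'
    have := hC.neBot
    obtain ⟨i, hi, a, ha, b, hb, hab⟩ := (h.and h').exists
    exact hi a ha b hb hab

/-- The element of the cohesive power given by a total computable function. -/
def ofComputable (C : Set ℕ) (h : ℕ → A.dom) (hh : Computable fun i => (h i : ℕ)) :
    A.PreElem C :=
  ⟨fun i => Part.some (h i), by simpa only [Part.map_some] using! hh.partrec, by
    rw [almostSubset_iff_eventually]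
    exact Filter.Eventually.of_forall fun i => trivial⟩

theorem powerFn_iterate_ofComputable_eq_iff (n m : ℕ) {h h' : ℕ → A.dom}
    (hh : Computable fun i => (h i : ℕ)) (hh' : Computable fun i => (h' i : ℕ)) :
    (A.powerFn C)^[n] (toPower (ofComputable C h hh)) =
        (A.powerFn C)^[m] (toPower (ofComputable C h' hh')) ↔
      ∀ᶠ i in Filter.cofinite ⊓ Filter.principal C, A.fn^[n] (h i) = A.fn^[m] (h' i) := by
  rw [powerFn_iterate_eq_iff]
  simp [ofComputable]

/-- The canonical embedding of a structure into its cohesive power. -/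
def constPower (C : Set ℕ) (a : A.dom) : A.Power C :=
  toPower (ofComputable C (fun _ => a) (Computable.const _))

theorem constPower_injective (hC : IsCohesive C) :
    Function.Injective (constPower C : A.dom → A.Power C) := by
  intro a b h
  have := hC.neBot
  simpa using (powerFn_iterate_ofComputable_eq_iff 0 0 (Computable.const _)
    (Computable.const _)).1 h

theorem powerFn_constPower (a : A.dom) :
    A.powerFn C (constPower C a) = constPower C (A.fn a) :=
  (powerFn_iterate_ofComputable_eq_iff 1 0 (Computable.const _) (Computable.const _)).2
    (Filter.Eventually.of_forall fun _ => rfl)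

instance : Countable (A.PreElem C) := by
  have h : ∀ ψ : A.PreElem C, ∃ c : Nat.Partrec.Code,
      c.eval = fun i => (ψ.1 i).map fun a : A.dom => (a : ℕ) :=
    fun ψ => Nat.Partrec.Code.exists_code.1 (Partrec.nat_iff.1 ψ.2.1)
  choose c hc using h
  refine Function.Injective.countable (f := c) fun ψ φ h => Subtype.ext (funext fun i => ?_)
  have h' : (ψ.1 i).map (fun a : A.dom => (a : ℕ)) = (φ.1 i).map fun a : A.dom => (a : ℕ) :=
    congrFun ((hc ψ).symm.trans ((congrArg _ h).trans (hc φ))) i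
  ext a
  have h'' := congrArg ((a : ℕ) ∈ ·) h'
  simpa [Subtype.coe_inj] using h''

instance : Countable (A.Power C) :=
  inferInstanceAs (Countable (Quotient (A.powerSetoid C)))

/-! ### Computable functions on the domain -/

/-- The function `R` on the domain extends to a partial computable function. -/
def IsPartrecOn (R : A.dom → A.dom) : Prop :=
  ∃ G : ℕ →. ℕ, Partrec G ∧ ∀ a : A.dom, G a = Part.some (R a : ℕ)

/-- Composition of an element of the cohesive power with a computable function. -/
def postcomp (R : A.dom → A.dom) (hR : IsPartrecOn R) (ψ : A.PreElem C) : A.PreElem C :=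
  ⟨fun i => (ψ.1 i).map R, by
    obtain ⟨G, hG, h⟩ := hR
    refine (Partrec.bind ψ.2.1 (hG.comp Computable.snd).to₂).of_eq fun i => ?_
    rw [Part.bind_map, Part.map_map, ← Part.bind_some_eq_map]
    exact congrArg _ (funext h), ψ.2.2⟩

/-- The extension of `R` may be partial, but the recursion starts in the domain and never leaves it,
so it always converges. -/
theorem computable_iterate {R : A.dom → A.dom} (hR : IsPartrecOn R) {q : ℕ → ℕ}
    (hq : Computable q) (a : A.dom) : Computable fun i => ((R^[q i] a : A.dom) : ℕ) := by
  obtain ⟨G, hG, h⟩ := hR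
  have hrec := Partrec.nat_rec (f := q) (g := fun _ => Part.some (a : ℕ))
    (h := fun _ (y : ℕ × ℕ) => G y.2) hq (Computable.const _).partrec
    (hG.comp (Computable.snd.comp Computable.snd)).to₂
  refine hrec.of_eq fun i => ?_
  change _ = Part.some ((R^[q i] a : A.dom) : ℕ)
  generalize q i = n
  induction n with
  | zero => rfl
  | succ n ih =>
    change Part.bind _ _ = _
    rw [ih]
    simp only [Part.bind_some, h, Function.iterate_succ_apply']

/-- The least preimage, under `F`, of a number in the set given by `D`, other than the
predecessor of `o`. -/
def searchPreimage (D : ℕ → Bool) (F : ℕ → ℕ) (n o : ℕ) : Part ℕ :=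
  Nat.rfind fun m => Part.some (D m && F m == n && !(o == m + 1))

theorem partrec_searchPreimage {D : ℕ → Bool} {F : ℕ → ℕ} (hD : Computable D)
    (hF : Computable F) : Partrec₂ (searchPreimage D F) := by
  have h₁ : Computable fun x : (ℕ × ℕ) × ℕ => D x.2 := hD.comp Computable.snd
  have h₂ : Computable fun x : (ℕ × ℕ) × ℕ => F x.2 == x.1.1 :=
    Primrec.beq.to_comp.comp (hF.comp Computable.snd) (Computable.fst.comp Computable.fst)
  have h₃ : Computable fun x : (ℕ × ℕ) × ℕ => !(x.1.2 == x.2 + 1) :=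
    Primrec.not.to_comp.comp (Primrec.beq.to_comp.comp (Computable.snd.comp Computable.fst)
      (Computable.succ.comp Computable.snd))
  have h₄ : Computable₂ fun (x : ℕ × ℕ) (m : ℕ) =>
      D m && F m == x.1 && !(x.2 == m + 1) :=
    Primrec.and.to_comp.comp (Primrec.and.to_comp.comp h₁ h₂) h₃
  exact Partrec.rfind h₄.partrec₂

theorem exists_preimage_selectors (hA : IsTwoToOne A.fn) :
    ∃ p : Bool → A.dom → A.dom, (∀ b, IsPartrecOn (p b)) ∧ (∀ b a, A.fn (p b a) = a) ∧
      ∀ a, p false a ≠ p true a := by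
  obtain ⟨F, hF, hFA⟩ := A.computable_fn
  obtain ⟨_, hD⟩ := A.computable_dom
  set D : ℕ → Bool := fun n => decide (n ∈ A.dom) with hDdef
  have hsearch : ∀ (a : A.dom) (o : ℕ), (∃ x, A.fn x = a ∧ o ≠ (x : ℕ) + 1) →
      ∃ x : A.dom, searchPreimage D F a o = Part.some (x : ℕ) ∧ A.fn x = a ∧ o ≠ (x : ℕ) + 1 := by
    rintro a o ⟨x, hx, ho⟩
    obtain ⟨m, hm, -⟩ := Nat.rfind_min' (p := fun m => D m && F m == a && !(o == m + 1))
      (m := x) (by simp [hDdef, hFA, hx, ho])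
    have hm' := Nat.rfind_spec hm
    simp only [PFun.coe_val, Part.mem_some_iff, Eq.comm (a := true), Bool.and_eq_true, hDdef,
      decide_eq_true_eq, beq_iff_eq, Bool.not_eq_true', beq_eq_false_iff_ne] at hm'
    obtain ⟨⟨hmD, hmF⟩, hmo⟩ := hm'
    refine ⟨⟨m, hmD⟩, Part.eq_some_iff.2 hm, Subtype.ext ?_, hmo⟩
    rw [← hFA]
    exact hmF
  -- The argument `0` has no predecessor, so the first search excludes nothing; the second is given
  -- `p₀ a + 1` and excludes `p₀ a`.
  have h₀ : ∀ a : A.dom, ∃ x : A.dom, searchPreimage D F a 0 = Part.some (x : ℕ) ∧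
      A.fn x = a ∧ 0 ≠ (x : ℕ) + 1 := by
    intro a
    obtain ⟨x, hx⟩ := hA.surjective a
    exact hsearch a 0 ⟨x, hx, by simp⟩
  choose p₀ hp₀ using h₀
  have h₁ : ∀ a : A.dom, ∃ x : A.dom,
      searchPreimage D F a ((p₀ a : ℕ) + 1) = Part.some (x : ℕ) ∧
      A.fn x = a ∧ (p₀ a : ℕ) + 1 ≠ (x : ℕ) + 1 := by
    intro a
    obtain ⟨x, hx, hne⟩ := Set.exists_ne_of_one_lt_ncard
      (show 1 < (A.fn ⁻¹' {a}).ncard by rw [hA.2 a]; decide) (p₀ a)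
    exact hsearch a _ ⟨x, hx, fun h => hne (Subtype.ext (Nat.succ.inj h)).symm⟩
  choose p₁ hp₁ using h₁
  have hG₀ : Partrec fun n => searchPreimage D F n 0 :=
    (partrec_searchPreimage hD hF).comp Computable.id (Computable.const _)
  refine ⟨fun b => bif b then p₁ else p₀, ?_, ?_,
    fun a h => (hp₁ a).2.2 (congrArg (fun x : A.dom => (x : ℕ) + 1) h)⟩
  · rintro (_ | _)
    · exact ⟨_, hG₀, fun a => (hp₀ a).1⟩
    · refine ⟨fun n => (searchPreimage D F n 0).bind fun g => searchPreimage D F n (g + 1),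
        hG₀.bind ((partrec_searchPreimage hD hF).comp Computable.fst
          (Computable.succ.comp Computable.snd)).to₂, fun a => ?_⟩
      change (searchPreimage D F a 0).bind _ = _
      rw [(hp₀ a).1, Part.bind_some]
      exact (hp₁ a).1
  · rintro (_ | _) a
    exacts [(hp₀ a).2.1, (hp₁ a).2.1]

/-! ### The cohesive power is two-to-one -/

theorem isTwoToOne_powerFn (hA : IsTwoToOne A.fn) (hC : IsCohesive C) :
    IsTwoToOne (A.powerFn C) := by
  obtain ⟨p, hpc, hp, hpne⟩ := exists_preimage_selectors hA
  have := hC.neBot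
  refine ⟨hA.1.map (constPower C), fun y => ?_⟩
  obtain ⟨ψ, rfl⟩ := toPower_surjective y
  have hmem : ∀ b, A.powerFn C (toPower (postcomp (p b) (hpc b) ψ)) = toPower ψ := by
    intro b
    refine (powerFn_iterate_eq_iff 1 0 _ _).2 (ψ.eventually_defined.mono ?_)
    rintro i ⟨a, ha⟩
    exact ⟨_, Part.mem_map (p b) ha, a, ha, hp b a⟩
  refine Set.ncard_eq_two.2 ⟨toPower (postcomp (p false) (hpc false) ψ),
    toPower (postcomp (p true) (hpc true) ψ), ?_, ?_⟩
  · refine (powerFn_iterate_ne_iff hC 0 0 _ _).2 (Filter.Eventually.of_forall ?_)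
    intro i a ha b hb
    obtain ⟨x, hx, rfl⟩ := (Part.mem_map_iff _).1 ha
    obtain ⟨y, hy, rfl⟩ := (Part.mem_map_iff _).1 hb
    obtain rfl := Part.mem_unique hx hy
    exact hpne x
  · ext z
    obtain ⟨φ, rfl⟩ := toPower_surjective z
    constructor
    · intro hz
      -- A third preimage in the power would, at a single index `i`, yield a third preimage in `A`.
      by_contra h
      simp only [Set.mem_insert_iff, Set.mem_singleton_iff, not_or] at h
      have h₀ := (powerFn_iterate_ne_iff hC 0 0 _ _).1 h.1
      have h₁ := (powerFn_iterate_ne_iff hC 0 0 _ _).1 h.2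
      have h₂ := (powerFn_iterate_eq_iff 1 0 _ _).1 hz
      obtain ⟨i, ⟨hi₀, hi₁⟩, x, hx, a, ha, hxa⟩ := ((h₀.and h₁).and h₂).exists
      rcases eq_or_eq_of_ncard_eq_two (hA.2 a) (hp false a) (hp true a) hxa (hpne a) with h | h
      · exact hi₀ x hx _ (Part.mem_map (p false) ha) h
      · exact hi₁ x hx _ (Part.mem_map (p true) ha) h
    · rintro (h | h)
      · rw [h]; exact hmem false
      · rw [h]; exact hmem true

/-! ### Cycles of the cohesive power -/

theorem minimalPeriod_constPower (hC : IsCohesive C) (a : A.dom) :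
    Function.minimalPeriod (A.powerFn C) (constPower C a) = Function.minimalPeriod A.fn a :=
  Function.minimalPeriod_eq_minimalPeriod_iff.2 fun n =>
    isPeriodicPt_hom (constPower_injective hC) powerFn_constPower n a

/-- A representative of `y` differing from every such constant eventually avoids the whole finite
set of points of minimal period `k`; yet by transfer its values eventually have minimal period `k`.
-/
theorem exists_constPower_eq (hC : IsCohesive C) {k : ℕ} (hk : 1 ≤ k)
    (hfin : {a : A.dom | Function.minimalPeriod A.fn a = k}.Finite) {y : A.Power C}
    (hy : Function.minimalPeriod (A.powerFn C) y = k) : ∃ a, constPower C a = y := by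
  obtain ⟨ψ, rfl⟩ := toPower_surjective y
  have := hC.neBot
  by_contra! h
  have h₁ : ∀ᶠ i in Filter.cofinite ⊓ Filter.principal C,
      ∀ a ∈ {a : A.dom | Function.minimalPeriod A.fn a = k}, a ∉ ψ.1 i := by
    rw [hfin.eventually_all]
    intro a _
    refine ((powerFn_iterate_ne_iff hC 0 0 _ _).1 (h a)).mono fun i hi ha => ?_
    exact hi a (Part.mem_some a) a ha rfl
  -- Minimal period `k` is decided by the equations with `d ≤ k`; being finitely many, they transfer
  -- simultaneously.
  have h₂ : ∀ᶠ i in Filter.cofinite ⊓ Filter.principal C, ∀ d ∈ Set.Iic k, ∀ a ∈ ψ.1 i,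
      A.fn^[d] a = a ↔ (A.powerFn C)^[d] (toPower ψ) = toPower ψ := by
    rw [(Set.finite_Iic k).eventually_all]
    intro d _
    by_cases hd : (A.powerFn C)^[d] (toPower ψ) = toPower ψ
    · refine ((powerFn_iterate_eq_iff d 0 _ _).1 hd).mono ?_
      rintro i ⟨a, ha, b, hb, hab⟩ c hc
      obtain rfl := Part.mem_unique ha hb
      obtain rfl := Part.mem_unique ha hc
      simp only [hd, iff_true]
      exact hab
    · refine ((powerFn_iterate_ne_iff hC d 0 _ _).1 hd).mono fun i hi a ha => ?_
      simp only [hd, iff_false]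
      exact hi a ha a ha
  obtain ⟨i, ⟨hi₁, hi₂⟩, a, ha⟩ := ((h₁.and h₂).and ψ.eventually_defined).exists
  refine hi₁ a ?_ ha
  have hak : Function.IsPeriodicPt A.fn k a :=
    (hi₂ k (Set.mem_Iic.2 le_rfl) a ha).2 (hy ▸ Function.isPeriodicPt_minimalPeriod _ _)
  refine le_antisymm (hak.minimalPeriod_le hk) ?_
  rw [← hy]
  refine Function.IsPeriodicPt.minimalPeriod_le (hak.minimalPeriod_pos hk) ?_
  exact (hi₂ _ (Set.mem_Iic.2 (hak.minimalPeriod_le hk)) a ha).1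
    (Function.isPeriodicPt_minimalPeriod _ _)

end ComputableUnaryStructure

/-! ### Counting cycles -/

theorem finite_minimalPeriod_of_finite_cycleOrbits {α : Type*} {f : α → α} (hf : IsTwoToOne f)
    {k : ℕ} (hk : 1 ≤ k) (h : (cycleOrbits f k).Finite) :
    {x | Function.minimalPeriod f x = k}.Finite := by
  rw [cycleOrbits_eq_image hf hk] at h
  refine Set.Finite.of_finite_fibers _ h ?_
  rintro _ ⟨x, hx, rfl⟩
  refine ((Set.finite_Iio k).image fun n => f^[n] x).subset ?_
  rintro y ⟨hy, hxy⟩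
  obtain ⟨n, m, h⟩ := mem_unaryOrbit_of_eq hxy
  have hx' : Function.minimalPeriod f x = k := hx
  have hyk : Function.IsPeriodicPt f k y := by
    have hy'' : Function.minimalPeriod f y = k := hy
    exact hy'' ▸ Function.isPeriodicPt_minimalPeriod f y
  have hn : n ≤ k * n := Nat.le_mul_of_pos_left n hk
  -- From `f^[n] y = f^[m] x`, a further `k * n - n` steps complete `n` turns of the cycle and
  -- return to `y`.
  refine ⟨(k * n - n + m) % k, Nat.mod_lt _ hk, ?_⟩
  change f^[(k * n - n + m) % k] x = y
  rw [← hx', Function.iterate_mod_minimalPeriod_eq, hx', Function.iterate_add_apply, ← h,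
    ← Function.iterate_add_apply, Nat.sub_add_cancel hn]
  exact hyk.mul_const n

theorem countable_cycleOrbits {α : Type*} [Countable α] (f : α → α) (k : ℕ) :
    (cycleOrbits f k).Countable := by
  refine (Set.countable_range (unaryOrbit f)).mono ?_
  rintro _ ⟨⟨a, rfl⟩, -⟩
  exact ⟨a, rfl⟩

namespace ComputableUnaryStructure

variable {A : ComputableUnaryStructure} {C : Set ℕ}

theorem mk_cycleOrbits_powerFn (hA : IsTwoToOne A.fn) (hC : IsCohesive C) {k : ℕ} (hk : 1 ≤ k) :
    Cardinal.mk (cycleOrbits (A.powerFn C) k) = Cardinal.mk (cycleOrbits A.fn k) := by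
  have hB := isTwoToOne_powerFn hA hC
  have hrep : ∀ O : cycleOrbits A.fn k,
      ∃ x, Function.minimalPeriod A.fn x = k ∧ unaryOrbit A.fn x = O := by
    rintro ⟨O, hO⟩
    rwa [cycleOrbits_eq_image hA hk] at hO
  choose r hr hrO using hrep
  let F : cycleOrbits A.fn k → cycleOrbits (A.powerFn C) k := fun O =>
    ⟨unaryOrbit (A.powerFn C) (constPower C (r O)), by
      rw [cycleOrbits_eq_image hB hk]
      exact ⟨_, (minimalPeriod_constPower hC _).trans (hr O), rfl⟩⟩
  have hF : Function.Injective F := by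
    intro O O' h
    obtain ⟨n, m, hnm⟩ := mem_unaryOrbit_of_eq (congrArg Subtype.val h)
    rw [iterate_hom powerFn_constPower, iterate_hom powerFn_constPower] at hnm
    apply Subtype.ext
    rw [← hrO, ← hrO, unaryOrbit_eq_of_iterate_eq (constPower_injective hC hnm)]
  by_cases hfin : (cycleOrbits A.fn k).Finite
  · have hfin' := finite_minimalPeriod_of_finite_cycleOrbits hA hk hfin
    refine (Cardinal.mk_congr (Equiv.ofBijective F ⟨hF, ?_⟩)).symm
    rintro ⟨O, hO⟩
    obtain ⟨y, hy, rfl⟩ := (cycleOrbits_eq_image hB hk) ▸ hO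
    obtain ⟨a, rfl⟩ := exists_constPower_eq hC hk hfin' hy
    have ha : unaryOrbit A.fn a ∈ cycleOrbits A.fn k := by
      rw [cycleOrbits_eq_image hA hk]
      exact ⟨a, (minimalPeriod_constPower hC a).symm.trans hy, rfl⟩
    refine ⟨⟨_, ha⟩, Subtype.ext ?_⟩
    obtain ⟨n, m, hnm⟩ := mem_unaryOrbit_of_eq (hrO ⟨_, ha⟩)
    refine unaryOrbit_eq_of_iterate_eq (n := n) (m := m) ?_
    rw [iterate_hom powerFn_constPower, iterate_hom powerFn_constPower, hnm]
  · have : Infinite (cycleOrbits A.fn k) := Set.infinite_coe_iff.2 hfin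
    have : Infinite (cycleOrbits (A.powerFn C) k) := Infinite.of_injective F hF
    have := (countable_cycleOrbits A.fn k).to_subtype
    have := (countable_cycleOrbits (A.powerFn C) k).to_subtype
    rw [Cardinal.mk_eq_aleph0, Cardinal.mk_eq_aleph0]

/-! ### Chains of the cohesive power -/

/-- `f` is injective on periodic points, so two preimages of one point cannot both be periodic. -/
theorem exists_notMem_periodicPts {α : Type*} {f : α → α} (hf : IsTwoToOne f) :
    ∃ a, a ∉ Function.periodicPts f := by
  obtain ⟨y⟩ := hf.1
  by_contra! h
  obtain ⟨u, v, huv, h'⟩ := Set.ncard_eq_two.1 (hf.2 y)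
  have hu : u ∈ f ⁻¹' {y} := by simp [h']
  have hv : v ∈ f ⁻¹' {y} := by simp [h']
  exact huv ((Function.bijOn_periodicPts f).injOn (h u) (h v)
    ((show f u = y from hu).trans (show f v = y from hv).symm))

theorem infinite_zChainOrbits_powerFn (hA : IsTwoToOne A.fn) (hC : IsCohesive C) :
    (zChainOrbits (A.powerFn C)).Infinite := by
  obtain ⟨p, hpc, hp, -⟩ := exists_preimage_selectors hA
  obtain ⟨a, ha⟩ := exists_notMem_periodicPts hA
  have hB := isTwoToOne_powerFn hA hC
  have := hC.neBot
  set s := p false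
  have hsn : ∀ n x, A.fn^[n] (s^[n] x) = x :=
    fun n => (show Function.RightInverse s A.fn from hp false).iterate n
  have hsub : ∀ n m, n ≤ m → A.fn^[n] (s^[m] a) = s^[m - n] a := by
    intro n m h
    obtain ⟨d, rfl⟩ := Nat.exists_eq_add_of_le h
    rw [Function.iterate_add_apply, hsn, Nat.add_sub_cancel_left]
  have hinj' : ∀ n m, n < m → s^[n] a ≠ s^[m] a := by
    intro n m h h'
    refine ha ⟨m - n, by omega, ?_⟩
    have := congrArg A.fn^[m] h'
    rw [hsn] at this
    obtain ⟨d, rfl⟩ := Nat.exists_eq_add_of_lt h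
    rw [show n + d + 1 = (d + 1) + n by omega, Function.iterate_add_apply, hsn] at this
    rw [show n + d + 1 - n = d + 1 by omega]
    exact this
  have hinj : ∀ n m, s^[n] a = s^[m] a → n = m := by
    intro n m h
    rcases lt_trichotomy n m with h' | h' | h'
    exacts [absurd h (hinj' n m h'), h', absurd h.symm (hinj' m n h')]
  -- The speed is `j + 1`, not `j`, so that the exponent is at least `i` and eventually exceeds any
  -- fixed `n` and `m`.
  have hc : ∀ j : ℕ, Computable fun i => ((s^[i * (j + 1)] a : A.dom) : ℕ) := fun j =>
    computable_iterate (hpc false)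
      (Primrec.nat_mul.to_comp.comp Computable.id (Computable.const _)) a
  let x : ℕ → A.Power C := fun j => toPower (ofComputable C _ (hc j))
  have key : ∀ j l n m, (A.powerFn C)^[n] (x j) = (A.powerFn C)^[m] (x l) →
      j = l ∧ n = m := by
    intro j l n m h
    have h₁ := (powerFn_iterate_ofComputable_eq_iff n m (hc j) (hc l)).1 h
    have hlarge : ∀ N, ∀ᶠ i in Filter.cofinite ⊓ Filter.principal C, N ≤ i := fun N =>
      Filter.Eventually.filter_mono inf_le_left
        (Nat.cofinite_eq_atTop ▸ Filter.eventually_ge_atTop N)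
    have h₂ : ∀ N, ∃ i, N ≤ i ∧ n + m ≤ i ∧ i * (j + 1) - n = i * (l + 1) - m := by
      intro N
      obtain ⟨i, ⟨hi, hN⟩, hnm⟩ := ((h₁.and (hlarge N)).and (hlarge (n + m))).exists
      have hj : i ≤ i * (j + 1) := Nat.le_mul_of_pos_right _ (by omega)
      have hl : i ≤ i * (l + 1) := Nat.le_mul_of_pos_right _ (by omega)
      refine ⟨i, hN, hnm, hinj _ _ ?_⟩
      rw [← hsub _ _ (by omega), ← hsub _ _ (by omega)]
      exact hi
    -- Two distinct indices suffice: subtracting the two linear equations gives `j = l`, and either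
    -- one then gives `n = m`.
    obtain ⟨i, -, hi, h₃⟩ := h₂ 0
    obtain ⟨i', hi', -, h₄⟩ := h₂ (i + 1)
    have e₁ : (i : ℤ) * (j + 1) - n = i * (l + 1) - m := by
      have hj : i ≤ i * (j + 1) := Nat.le_mul_of_pos_right _ (by omega)
      have hl : i ≤ i * (l + 1) := Nat.le_mul_of_pos_right _ (by omega)
      zify [show n ≤ i * (j + 1) by omega, show m ≤ i * (l + 1) by omega] at h₃
      exact h₃
    have e₂ : (i' : ℤ) * (j + 1) - n = i' * (l + 1) - m := by
      have hj : i' ≤ i' * (j + 1) := Nat.le_mul_of_pos_right _ (by omega)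
      have hl : i' ≤ i' * (l + 1) := Nat.le_mul_of_pos_right _ (by omega)
      zify [show n ≤ i' * (j + 1) by omega, show m ≤ i' * (l + 1) by omega] at h₄
      exact h₄
    have e₃ : ((i' : ℤ) - i) * ((j : ℤ) - l) = 0 := by linear_combination e₂ - e₁
    have hjl : (j : ℤ) = l := by
      rcases mul_eq_zero.1 e₃ with h | h <;> omega
    rw [hjl] at e₁
    exact ⟨by omega, by omega⟩
  refine Set.infinite_of_injective_forall_mem (f := fun j => unaryOrbit (A.powerFn C) (x j))
    ?_ fun j => hB.mem_zChainOrbits fun n m h => (key j j n m h).2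
  intro j l h
  obtain ⟨n, m, hnm⟩ := mem_unaryOrbit_of_eq h
  exact (key j l n m hnm).1

theorem unaryIso_powerFn (hA : IsTwoToOne A.fn) (hC : IsCohesive C)
    (h : (zChainOrbits A.fn).Infinite) : UnaryIso A.fn (A.powerFn C) := by
  refine hA.unaryIso_of_cycleOrbits (isTwoToOne_powerFn hA hC) fun k => ?_
  rcases Nat.eq_zero_or_pos k with rfl | hk
  -- `cycleOrbits _ 0` is `zChainOrbits` by definition, so both sides are countably infinite.
  · have := (countable_cycleOrbits A.fn 0).to_subtype
    have := (countable_cycleOrbits (A.powerFn C) 0).to_subtype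
    have : Infinite (cycleOrbits A.fn 0) := h.to_subtype
    have : Infinite (cycleOrbits (A.powerFn C) 0) :=
      (infinite_zChainOrbits_powerFn hA hC).to_subtype
    exact nonempty_equiv_of_countable
  · exact Cardinal.eq.1 (mk_cycleOrbits_powerFn hA hC hk).symm

end ComputableUnaryStructure

theorem mainTheorem3 (A : ComputableUnaryStructure) (hA : IsTwoToOne A.fn)
    (C : Set ℕ) (hC : IsCohesive C) :
    IsTwoToOne (A.powerFn C) ∧
    (∀ k : ℕ, 1 ≤ k →
      Cardinal.mk (cycleOrbits (A.powerFn C) k) = Cardinal.mk (cycleOrbits A.fn k)) ∧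
    (zChainOrbits (A.powerFn C)).Infinite ∧
    ((zChainOrbits A.fn).Finite → ¬ UnaryIso A.fn (A.powerFn C)) ∧
    (UnaryIso A.fn (A.powerFn C) ↔ (zChainOrbits A.fn).Infinite) := by
  have hinf := ComputableUnaryStructure.infinite_zChainOrbits_powerFn hA hC
  exact ⟨ComputableUnaryStructure.isTwoToOne_powerFn hA hC,
    fun _ hk => ComputableUnaryStructure.mk_cycleOrbits_powerFn hA hC hk, hinf,
    fun hfin h => h.symm.infinite_zChainOrbits hinf hfin,
    fun h => h.symm.infinite_zChainOrbits hinf,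
    ComputableUnaryStructure.unaryIso_powerFn hA hC⟩
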